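/- Let $\mathbf{k}$ be a field and let $\mathcal{C}$ be a tensor category over $\mathbf{k}$: a $\mathbf{k}$-linear abelian rigid monoidal category with bilinear tensor product, in which every object has finite length and the map $\mathbf{k}\to\mathrm{End}(\mathbb{1})$ is an isomorphism. For $X\in\mathcal{C}$ let $X^*$ be the dual with evaluation $X^*\otimes X\to\mathbb{1}$ and coevaluation $\mathbb{1}\to X\otimes X^*$, put $X^{(0)}=X$ and $X^{(n+1)}=(X^{(n)})^*$, and let $F_n=-\otimes X^{(n)}$, so that $F_0\dashv F_1\dashv F_2\dashv\cdots$. These functors are exact and act termwise on complexes in $\mathcal{C}$. Define endofunctors $E_n$ and $E^n$ of the category of complexes in $\mathcal{C}$ by $E_0=E^0=\mathrm{id}$, $E_1=E^1=F_0$ and, for $n\ge 2$, $$E_n(K)=\mathrm{Cone}\big(E_{n-1}(F_{n-1}K)\xrightarrow{f_{n-1}}E_{n-2}(K)\big)[-1],\qquad E^n(K)=\mathrm{Cone}\big(E^{n-2}(K)\xrightarrow{g_{n-1}}F_{n-1}E^{n-1}(K)\big).$$ Here $f_n$ is the composite $E_n(F_nK)\to E_{n-1}(F_{n-1}F_nK)\to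 E_{n-1}(K)$ of the canonical map $\phi_n:E_n\to E_{n-1}F_{n-1}$ (for $n=1$ the identity, for $n\ge2$ the projection from the shifted cone) and the counit $F_{n-1}F_n\to\mathrm{id}$. Dually, $g_n$ is the composite $E^{n-1}(K)\to F_nF_{n-1}E^{n-1}(K)\to F_nE^n(K)$ of the unit $\mathrm{id}\to F_nF_{n-1}$ and the canonical map $\psi_n:F_{n-1}E^{n-1}\to E^n$ (for $n=1$ the identity, for $n\ge2$ the inclusion into the cone). For an integer $N>0$, the object $X$ is called $N$-bounded if the endofunctor $-\otimes X$ of the derived category $\mathcal{D}(\mathcal{C})$ is $N$-spherical, that is, if the endofunctors of $\mathcal{D}(\mathcal{C})$ induced by $E_{N-1}$ and $E^{N-1}$ are both zero (equivalently, $E_{N-1}(K)$ and $E^{N-1}(K)$ are acyclic for every complex $K$). The object $X$ is bounded if it is $N$-bounded for some $N>0$. **Theorem.** Every bounded object $X$ of $\mathcal{C}$ is simple or zero. -/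

import Mathlib

open CategoryTheory Limits MonoidalCategory

universe v u w w'

namespace BoundedObj

noncomputable section

/-! ### Functorial cones and fibres of cochain complexes -/

section Cones

variable {J : Type w} [Category.{w'} J] {A : Type u} [Category.{v} A] [Preadditive A]
  [HasBinaryBiproducts A] {S T : J ⥤ CochainComplex A ℤ}

/-- The cone `K ↦ Cone (τ_K : S K ⟶ T K)` of a natural transformation of functors with values in
cochain complexes. -/
def coneFunctor (τ : S ⟶ T) : J ⥤ CochainComplex A ℤ where
  obj K := CochainComplex.mappingCone (τ.app K)
  map {K L} g := CochainComplex.mappingCone.map (τ.app K) (τ.app L) (S.map g) (T.map g)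
    (τ.naturality g).symm
  map_id K := by
    rw [← CochainComplex.mappingCone.map_id]
    congr 1 <;> exact CategoryTheory.Functor.map_id _ _
  map_comp g h := by
    rw [← CochainComplex.mappingCone.map_comp]
    congr 1 <;> exact CategoryTheory.Functor.map_comp _ _ _

/-- The canonical inclusion `T ⟶ Cone τ`. -/
def coneInr (τ : S ⟶ T) : T ⟶ coneFunctor τ where
  app K := CochainComplex.mappingCone.inr (τ.app K)
  naturality K L g := by
    dsimp only [coneFunctor]
    simp [CochainComplex.mappingCone.map]

/-- The fibre `K ↦ Cone (τ_K)[-1]` of a natural transformation of functors with values in cochain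
complexes. -/
def fibFunctor (τ : S ⟶ T) : J ⥤ CochainComplex A ℤ where
  obj K := CochainComplex.mappingCocone (τ.app K)
  map g := ((coneFunctor τ).map g)⟦(-1 : ℤ)⟧'
  map_id K := (coneFunctor τ ⋙ shiftFunctor (CochainComplex A ℤ) (-1 : ℤ)).map_id K
  map_comp g h := (coneFunctor τ ⋙ shiftFunctor (CochainComplex A ℤ) (-1 : ℤ)).map_comp g h

/-- The canonical projection `Cone(τ)[-1] ⟶ S`. -/
def fibFst (τ : S ⟶ T) : fibFunctor τ ⟶ S where
  app K := CochainComplex.mappingCocone.fst (τ.app K)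
  naturality K L g := by
    ext n
    have h : ((coneFunctor τ).map g).f (n + -1) ≫
        (CochainComplex.mappingCone.fst (τ.app L)).1.v (n + -1) n (by lia) =
          (CochainComplex.mappingCone.fst (τ.app K)).1.v (n + -1) n (by lia) ≫ (S.map g).f n := by
      dsimp only [coneFunctor]
      simp [CochainComplex.mappingCone.ext_from_iff _ n (n + -1) (by lia),
        CochainComplex.mappingCone.map]
    have e (M : J) : (CochainComplex.mappingCocone.fst (τ.app M)).f n =
        (CochainComplex.mappingCone.fst (τ.app M)).1.v (n + -1) n (by lia) := by
      simp only [CochainComplex.mappingCocone.fst, HomologicalComplex.neg_f_apply,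
        CochainComplex.HomComplex.Cocycle.homOf_f, CochainComplex.HomComplex.Cocycle.leftShift_coe,
        CochainComplex.HomComplex.Cochain.leftShift_v (n := 1) _ (-1) 0 (add_neg_cancel 1) n n
          (by lia) (n + -1) (by lia)]
      have e' : ((-1 : ℤ) * 0 + -1 * (-1 - 1) / 2).negOnePow = -1 := by decide
      rw [e', Units.neg_smul, one_smul, neg_neg]
      exact Category.id_comp _
    change ((coneFunctor τ).map g).f (n + -1) ≫ (CochainComplex.mappingCocone.fst (τ.app L)).f n =
      (CochainComplex.mappingCocone.fst (τ.app K)).f n ≫ (S.map g).f n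
    rw [e, e]
    exact h

end Cones

/-! ### Continuants of a functor with iterated right adjoints -/

section Continuants

variable {A : Type u} [Category.{v} A] [Preadditive A]
  (F : ℕ → A ⥤ A) [∀ n, (F n).Additive] (adj : ∀ n, F n ⊣ F (n + 1))

/-- The functor induced by `F n` on cochain complexes. -/
abbrev onComplexes (n : ℕ) : CochainComplex A ℤ ⥤ CochainComplex A ℤ :=
  (F n).mapHomologicalComplex (ComplexShape.up ℤ)

variable {F}

/-- The counit of `F n ⊣ F (n + 1)` on cochain complexes. -/
def counitOnComplexes (n : ℕ) : onComplexes F (n + 1) ⋙ onComplexes F n ⟶ 𝟭 _ where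
  app K :=
    { f := fun i => (adj n).counit.app (K.X i)
      comm' := fun i j _ => ((adj n).counit.naturality (K.d i j)).symm }
  naturality K L g := by ext i; exact (adj n).counit.naturality (g.f i)

/-- The unit of `F n ⊣ F (n + 1)` on cochain complexes. -/
def unitOnComplexes (n : ℕ) : 𝟭 _ ⟶ onComplexes F n ⋙ onComplexes F (n + 1) where
  app K :=
    { f := fun i => (adj n).unit.app (K.X i)
      comm' := fun i j _ => ((adj n).unit.naturality (K.d i j)).symm }
  naturality K L g := by ext i; exact (adj n).unit.naturality (g.f i)

variable (F)

/-- Two consecutive lower continuant functors `prev = E_n`, `curr = E_{n+1}`, together with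
`φ_{n+1} : E_{n+1}(K) ⟶ E_n(F_n K)`. -/
structure LowerStep (n : ℕ) where
  prev : CochainComplex A ℤ ⥤ CochainComplex A ℤ
  curr : CochainComplex A ℤ ⥤ CochainComplex A ℤ
  φ : curr ⟶ onComplexes F n ⋙ prev

/-- Two consecutive upper continuant functors `prev = E^n`, `curr = E^{n+1}`, together with
`ψ_{n+1} : F_n (E^n(K)) ⟶ E^{n+1}(K)`. -/
structure UpperStep (n : ℕ) where
  prev : CochainComplex A ℤ ⥤ CochainComplex A ℤ
  curr : CochainComplex A ℤ ⥤ CochainComplex A ℤ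
  ψ : prev ⋙ onComplexes F n ⟶ curr

variable {F}

/-- The morphism `f_{n+1} : E_{n+1}(F_{n+1} K) ⟶ E_n(F_n F_{n+1} K) ⟶ E_n(K)` adjoint to
`φ_{n+1}`. -/
def LowerStep.f {n : ℕ} (s : LowerStep F n) : onComplexes F (n + 1) ⋙ s.curr ⟶ s.prev :=
  Functor.whiskerLeft (onComplexes F (n + 1)) s.φ ≫
    Functor.whiskerRight (counitOnComplexes adj n) s.prev

/-- The morphism `g_{n+1} : E^n(K) ⟶ F_{n+1} F_n (E^n(K)) ⟶ F_{n+1} (E^{n+1}(K))` adjoint to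
`ψ_{n+1}`. -/
def UpperStep.g {n : ℕ} (s : UpperStep F n) : s.prev ⟶ s.curr ⋙ onComplexes F (n + 1) :=
  Functor.whiskerLeft s.prev (unitOnComplexes adj n) ≫
    Functor.whiskerRight s.ψ (onComplexes F (n + 1))

variable [HasBinaryBiproducts A]

/-- `E_0 = id`, `E_1 = F_0` and `E_{n+2}(K) = Cone (f_{n+1} : E_{n+1}(F_{n+1} K) ⟶ E_n(K))[-1]`. -/
def lowerStep : (n : ℕ) → LowerStep F n
  | 0 => { prev := 𝟭 _, curr := onComplexes F 0, φ := (Functor.rightUnitor _).inv }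
  | n + 1 =>
    { prev := (lowerStep n).curr
      curr := fibFunctor ((lowerStep n).f adj)
      φ := fibFst ((lowerStep n).f adj) }

/-- `E^0 = id`, `E^1 = F_0` and `E^{n+2}(K) = Cone (g_{n+1} : E^n(K) ⟶ F_{n+1} (E^{n+1}(K)))`. -/
def upperStep : (n : ℕ) → UpperStep F n
  | 0 => { prev := 𝟭 _, curr := onComplexes F 0, ψ := (Functor.leftUnitor _).hom }
  | n + 1 =>
    { prev := (upperStep n).curr
      curr := coneFunctor ((upperStep n).g adj)
      ψ := coneInr ((upperStep n).g adj) }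

/-- The lower continuant endofunctor `E_n` of `F_0, F_1, …`. -/
def lowerContinuant (n : ℕ) : CochainComplex A ℤ ⥤ CochainComplex A ℤ := (lowerStep adj n).prev

/-- The upper continuant endofunctor `E^n` of `F_0, F_1, …`. -/
def upperContinuant (n : ℕ) : CochainComplex A ℤ ⥤ CochainComplex A ℤ := (upperStep adj n).prev

/-- Let `F_0 ⊣ F_1 ⊣ ⋯` be exact endofunctors of an abelian category, viewed as endofunctors of the
derived category. The functor `F_0` is `N`-spherical, `N > 0`, if the continuant endofunctors
`E_{N-1}` and `E^{N-1}` of the derived category vanish, that is, if their values on all complexes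
are acyclic. -/
def IsNSpherical (N : ℕ) : Prop :=
  0 < N ∧ ∀ K : CochainComplex A ℤ,
    ((lowerContinuant adj (N - 1)).obj K).Acyclic ∧ ((upperContinuant adj (N - 1)).obj K).Acyclic

end Continuants

/-! ### Tensor categories and bounded objects -/

section Tensor

/-- Tensor categories over a field `k`: `k`-linear abelian rigid monoidal categories with bilinear
tensor product, in which the unit has endomorphism ring `k` and all objects have finite length
(the lengths of strictly increasing chains of subobjects are bounded). -/
class IsTensorCategory (k : Type w) [Field k] (C : Type u) [Category.{v} C] [Abelian C]
    [Linear k C] [MonoidalCategory C] [MonoidalPreadditive C] [MonoidalLinear k C]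
    [RigidCategory C] : Prop where
  end_unit : Function.Bijective (fun a : k => a • 𝟙 (𝟙_ C))
  finite_length : ∀ X : C, FiniteDimensionalOrder (Subobject X)

variable {C : Type u} [Category.{v} C] [MonoidalCategory C]

/-- The iterated duals `X^{(0)} = X`, `X^{(1)} = X^*`, `X^{(2)} = X^{**}`, …, where the dual `X^*`
comes with `ev : X^* ⊗ X ⟶ 𝟙` and `co : 𝟙 ⟶ X ⊗ X^*`; this dual is written `Xᘁ` in Mathlib. -/
def iteratedDual [RightRigidCategory C] (X : C) : ℕ → C
  | 0 => X
  | n + 1 => (iteratedDual X n)ᘁ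

/-- The adjunction `- ⊗ X^{(n)} ⊣ - ⊗ X^{(n+1)}`. -/
def tensorDualAdjunction [RightRigidCategory C] (X : C) (n : ℕ) :
    tensorRight (iteratedDual X n) ⊣ tensorRight (iteratedDual X (n + 1)) :=
  tensorRightAdjunction (iteratedDual X n) (iteratedDual X n)ᘁ

variable [Abelian C] [MonoidalPreadditive C] [RightRigidCategory C]

/-- `X` is `N`-bounded if the endofunctor `- ⊗ X` of the derived category is `N`-spherical. -/
def IsNBounded (N : ℕ) (X : C) : Prop :=
  IsNSpherical (F := fun n => tensorRight (iteratedDual X n)) (tensorDualAdjunction X) N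

/-- `X` is bounded if it is `N`-bounded for some `N > 0`. -/
def IsBounded (X : C) : Prop := ∃ N : ℕ, IsNBounded N X

end Tensor

end

end BoundedObj

/-! Length `ℓ` is additive on short exact sequences, so the Euler characteristic of `E_n(𝟙)` is an
integer `c_n(𝟙)`, where `c_0 = ℓ`, `c_1(K) = ℓ(K ⊗ X)` and `c_{n+2}(K) = c_{n+1}(K ⊗ X_{n+1}) -
c_n(K)`, with `X_n` the iterated duals (`eulerChar_lowerStep`). Boundedness makes `E_{N-1}(𝟙)`
acyclic, hence `c_{N-1}(𝟙) = 0`.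

If `X` is neither simple nor zero, it is an extension of nonzero objects `Y`, `Z`, and `c_{n+1}(K ⊗
X_{n+1})` splits into a `Y` part and a `Z` part. The unit is simple (`simple_unit`), so evaluations
of nonzero objects are epi and `K` is a quotient of `K ⊗ Y_{n+1} ⊗ Y_n`, likewise for `Z`. By
induction each part alone is at least `c_n(K)`, whence `c_{n+2} ≥ c_n` (`continuant_mono`). As
`c_0(𝟙), c_1(𝟙) > 0`, no `c_n(𝟙)` vanishes (`continuant_pos`), a contradiction. -/

namespace BoundedObj

noncomputable section

/-! ### Length of objects of an abelian category -/

section Length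

variable {C : Type u} [Category.{v} C]

/-- The length of an object of finite length in an abelian category, and the junk value `0`
on objects of infinite length. -/
def objLength (X : C) : ℕ := (Order.height (⊤ : Subobject X)).toNat

lemma height_lt_top {X : C} [FiniteDimensionalOrder (Subobject X)] (P : Subobject X) :
    Order.height P < ⊤ := by
  rw [lt_top_iff_ne_top, ne_eq, ← WithBot.coe_inj]
  exact ((Order.height_le_krullDim P).trans_lt
    (lt_top_iff_ne_top.2 Order.krullDim_ne_top_of_finiteDimensionalOrder)).ne

lemma isArtinianObject_of_finiteDimensionalOrder (X : C) [FiniteDimensionalOrder (Subobject X)] :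
    IsArtinianObject X := by
  rw [isArtinianObject_iff_not_strictAnti]
  intro φ hφ
  let p : LTSeries (Subobject X) :=
    { length := (LTSeries.longestOf (Subobject X)).length + 1
      toFun i := φ i.rev
      step i := hφ (by
        simp only [Fin.rev_castSucc, Fin.rev_succ, Fin.val_succ, Fin.val_castSucc]
        lia) }
  exact absurd (LTSeries.longestOf_is_longest p) (Nat.not_succ_le_self _)

variable [Abelian C]

/-- A subobject of the middle term of a short exact sequence is determined, among the subobjects
comparable with it, by its intersection with the first term and its image in the third term. -/
lemma subobject_eq_of_le_of_pullback_eq_of_image_eq {S : ShortComplex C} (hS : S.ShortExact)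
    {P Q : Subobject S.X₂} (h : P ≤ Q)
    (h₁ : (Subobject.pullback S.f).obj P = (Subobject.pullback S.f).obj Q)
    (h₂ : imageSubobject (P.arrow ≫ S.g) = imageSubobject (Q.arrow ≫ S.g)) : P = Q := by
  have := hS.mono_f
  have : Epi (Subobject.ofLE P Q h) := by
    rw [epi_iff_surjective_up_to_refinements]
    intro A y
    -- After a refinement, the image of `y` in `S.X₃` lifts to `s` in `P`. Then `y - s` lies in `Q ∩
    -- S.X₁ = P ∩ S.X₁`, so `y` lies in `P`.
    have fac : (imageSubobject (P.arrow ≫ S.g)).Factors ((y ≫ Q.arrow) ≫ S.g) := by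
      rw [h₂, Category.assoc]
      exact imageSubobject_factors_comp_self (Q.arrow ≫ S.g) y
    obtain ⟨A', π, hπ, s, hs⟩ := surjective_up_to_refinements_of_epi
      (factorThruImageSubobject (P.arrow ≫ S.g)) (Subobject.factorThru _ _ fac)
    have hs' : π ≫ (y ≫ Q.arrow) ≫ S.g = s ≫ P.arrow ≫ S.g := by
      have := hs =≫ (imageSubobject (P.arrow ≫ S.g)).arrow
      simpa using this
    have hz : (π ≫ y ≫ Q.arrow - s ≫ P.arrow) ≫ S.g = 0 := by
      simp only [Preadditive.sub_comp, Category.assoc] at hs' ⊢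
      rw [hs', sub_self]
    let a : A' ⟶ S.X₁ := hS.exact.lift _ hz
    have ha : a ≫ S.f = π ≫ y ≫ Q.arrow - s ≫ P.arrow := hS.exact.lift_f _ hz
    let q : A' ⟶ ((Subobject.pullback S.f).obj Q : C) :=
      (Subobject.isPullback S.f Q).lift (π ≫ y - s ≫ Subobject.ofLE P Q h) a (by
        rw [ha]; simp)
    have hq : q ≫ ((Subobject.pullback S.f).obj Q).arrow = a :=
      (Subobject.isPullback S.f Q).lift_snd _ _ _
    have hfac : ((Subobject.pullback S.f).obj P).Factors a := by
      rw [h₁, ← hq]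
      exact Subobject.factors_comp_arrow _
    let t : A' ⟶ (P : C) := Subobject.factorThru _ a hfac ≫ Subobject.pullbackπ S.f P
    have ht : t ≫ P.arrow = a ≫ S.f := by
      simp only [t, Category.assoc, (Subobject.isPullback S.f P).w]
      rw [← Category.assoc, Subobject.factorThru_arrow]
    refine ⟨A', π, hπ, t + s, ?_⟩
    rw [← cancel_mono Q.arrow]
    simp [ht, ha]
  have : IsIso (Subobject.ofLE P Q h) := isIso_of_mono_of_epi _
  exact le_antisymm h (Subobject.le_of_comm (inv (Subobject.ofLE P Q h)) (by simp))

/-- A strictly monotone function to `ℕ` bounds heights; here it is the length of the intersection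
with `S.X₁` plus the length of the image in `S.X₃`. -/
lemma height_top_le_of_shortExact {S : ShortComplex C} (hS : S.ShortExact)
    [FiniteDimensionalOrder (Subobject S.X₁)] [FiniteDimensionalOrder (Subobject S.X₃)] :
    Order.height (⊤ : Subobject S.X₂) ≤
      Order.height (⊤ : Subobject S.X₁) + Order.height (⊤ : Subobject S.X₃) := by
  let φ (P : Subobject S.X₂) : ℕ := (Order.height ((Subobject.pullback S.f).obj P)).toNat +
    (Order.height (imageSubobject (P.arrow ≫ S.g))).toNat
  have hle {P Q : Subobject S.X₂} (h : P ≤ Q) :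
      imageSubobject (P.arrow ≫ S.g) ≤ imageSubobject (Q.arrow ≫ S.g) := by
    have e : P.arrow ≫ S.g = Subobject.ofLE P Q h ≫ Q.arrow ≫ S.g := by simp
    simp only [e]
    exact imageSubobject_comp_le _ _
  have toNat_lt {a b : ℕ∞} (h : a < b) (hb : b < ⊤) : a.toNat < b.toNat := by
    lift a to ℕ using (h.trans hb).ne
    lift b to ℕ using hb.ne
    simpa using h
  have hφ : StrictMono φ := by
    intro P Q h
    have hm := (Subobject.pullback S.f).monotone h.le
    have hm' := hle h.le
    by_cases h₁ : (Subobject.pullback S.f).obj P = (Subobject.pullback S.f).obj Q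
    · by_cases h₂ : imageSubobject (P.arrow ≫ S.g) = imageSubobject (Q.arrow ≫ S.g)
      · exact absurd (subobject_eq_of_le_of_pullback_eq_of_image_eq hS h.le h₁ h₂) h.ne
      · refine add_lt_add_of_le_of_lt (ENat.toNat_le_toNat (Order.height_mono hm) (height_lt_top _).ne) ?_
        have := Order.height_strictMono (lt_of_le_of_ne hm' h₂) (height_lt_top _)
        exact toNat_lt this (height_lt_top _)
    · refine add_lt_add_of_lt_of_le ?_ (ENat.toNat_le_toNat (Order.height_mono hm') (height_lt_top _).ne)
      have := Order.height_strictMono (lt_of_le_of_ne hm h₁) (height_lt_top _)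
      exact toNat_lt this (height_lt_top _)
  refine (Order.height_le_height_apply_of_strictMono φ hφ ⊤).trans ?_
  rw [Order.height_nat]
  simp only [φ, Nat.cast_add, ENat.natCast_toNat (height_lt_top _).ne]
  exact add_le_add (Order.height_mono le_top) (Order.height_mono le_top)

/-- Chains in `S.X₁` pushed forward and chains in `S.X₃` pulled back are concatenated at the
subobject `S.X₁`: its height plus its coheight is at most the Krull dimension. -/
lemma le_height_top_of_shortExact {S : ShortComplex C} (hS : S.ShortExact) :
    Order.height (⊤ : Subobject S.X₁) + Order.height (⊤ : Subobject S.X₃) ≤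
      Order.height (⊤ : Subobject S.X₂) := by
  have := hS.mono_f
  have := hS.epi_g
  have hmap : StrictMono (Subobject.map S.f).obj :=
    (Subobject.map S.f).monotone.strictMono_of_injective (Subobject.map_obj_injective S.f)
  have hpull : StrictMono (Subobject.pullback S.g).obj := by
    refine (Subobject.pullback S.g).monotone.strictMono_of_injective fun P Q h => ?_
    have aux {P Q : Subobject S.X₃}
        (h : (Subobject.pullback S.g).obj P = (Subobject.pullback S.g).obj Q) : P ≤ Q := by
      have : Epi (Subobject.pullbackπ S.g P) :=
        Abelian.epi_fst_of_isLimit _ _ (Subobject.isPullback S.g P).isLimit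
      have hz : P.arrow ≫ cokernel.π Q.arrow = 0 := by
        have hfac : ((Subobject.pullback S.g).obj Q).Factors
            ((Subobject.pullback S.g).obj P).arrow := by
          rw [← h]
          exact Subobject.factors_self _
        rw [← cancel_epi (Subobject.pullbackπ S.g P), ← Category.assoc,
          (Subobject.isPullback S.g P).w, ← Subobject.factorThru_arrow _ _ hfac, Category.assoc,
          Category.assoc, ← Category.assoc _ S.g, ← (Subobject.isPullback S.g Q).w]
        simp
      exact Subobject.le_of_comm (Abelian.monoLift Q.arrow P.arrow hz)
        (Abelian.monoLift_comp Q.arrow P.arrow hz)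
    exact le_antisymm (aux h) (aux h.symm)
  have hle : (Subobject.map S.f).obj ⊤ ≤ (Subobject.pullback S.g).obj ⊥ := by
    rw [Subobject.top_eq_id, Subobject.map_mk]
    exact Subobject.mk_le_of_comm
      ((Subobject.isPullback S.g ⊥).lift 0 S.f (by simp [S.zero]))
      (by rw [(Subobject.isPullback S.g ⊥).lift_snd, Category.id_comp])
  have e (X : C) : Order.height (⊤ : Subobject X) = Order.coheight (⊥ : Subobject X) := by
    apply WithBot.coe_injective
    rw [Order.height_top_eq_krullDim, Order.coheight_bot_eq_krullDim]
  have h₁ := Order.height_le_height_apply_of_strictMono _ hmap ⊤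
  have h₃ := Order.coheight_le_coheight_apply_of_strictMono _ hpull ⊥
  have h₄ := Order.coheight_anti hle
  apply WithBot.coe_le_coe.1
  rw [Order.height_top_eq_krullDim, Order.krullDim_eq_iSup_height_add_coheight_of_nonempty]
  refine WithBot.coe_le_coe.2 (le_trans ?_ (le_iSup _ ((Subobject.map S.f).obj ⊤)))
  exact add_le_add h₁ ((e _).le.trans (h₃.trans h₄))

lemma objLength_eq_add [∀ X : C, FiniteDimensionalOrder (Subobject X)] {S : ShortComplex C}
    (hS : S.ShortExact) : objLength S.X₂ = objLength S.X₁ + objLength S.X₃ := by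
  rw [objLength, le_antisymm (height_top_le_of_shortExact hS) (le_height_top_of_shortExact hS),
    ENat.toNat_add (height_lt_top _).ne (height_lt_top _).ne]
  rfl

lemma objLength_pos [∀ X : C, FiniteDimensionalOrder (Subobject X)] {X : C} (hX : ¬ IsZero X) :
    0 < objLength X := by
  have := Subobject.nontrivial_of_not_isZero hX
  rw [objLength, Nat.pos_iff_ne_zero, ne_eq, ENat.toNat_eq_zero]
  simp [(height_lt_top (⊤ : Subobject X)).ne]

end Length

/-! ### Additive functions and Euler characteristics -/

section Euler

variable {A : Type u} [Category.{v} A] [Abelian A]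

/-- Functions on objects that are additive on short exact sequences. -/
def IsAdditiveFunction (f : A → ℤ) : Prop :=
  ∀ ⦃S : ShortComplex A⦄, S.ShortExact → f S.X₂ = f S.X₁ + f S.X₃

namespace IsAdditiveFunction

variable {f g : A → ℤ}

lemma of_isZero (hf : IsAdditiveFunction f) {X : A} (hX : IsZero X) : f X = 0 := by
  have : f X = f X + f X := hf (S := ShortComplex.mk (𝟙 X) (𝟙 X) (hX.eq_of_src _ _))
    { exact := ShortComplex.exact_of_isZero_X₂ _ hX
      mono_f := inferInstanceAs (Mono (𝟙 X))
      epi_g := inferInstanceAs (Epi (𝟙 X)) }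
  lia

lemma congr_iso (hf : IsAdditiveFunction f) {X Y : A} (e : X ≅ Y) : f X = f Y := by
  obtain ⟨O, hO⟩ := HasZeroObject.zero (C := A)
  have : f Y = f X + f O := hf (S := ShortComplex.mk e.hom (0 : Y ⟶ O) comp_zero)
    { exact := (ShortComplex.exact_iff_epi _ rfl).2 (inferInstanceAs (Epi e.hom))
      mono_f := inferInstanceAs (Mono e.hom)
      epi_g := hO.epi (0 : Y ⟶ O) }
  rw [this, hf.of_isZero hO, add_zero]

lemma sub (hf : IsAdditiveFunction f) (hg : IsAdditiveFunction g) :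
    IsAdditiveFunction (fun X => f X - g X) := fun S hS => by
  simp only [hf hS, hg hS]
  lia

lemma comp_functor (hf : IsAdditiveFunction f) (F : A ⥤ A) [F.PreservesZeroMorphisms]
    [PreservesFiniteLimits F] [PreservesFiniteColimits F] :
    IsAdditiveFunction (fun X => f (F.obj X)) := fun _ hS => hf (hS.map_of_exact F)

lemma le_of_epi (hf : IsAdditiveFunction f) (hf₀ : ∀ X, 0 ≤ f X) {X Y : A} (p : X ⟶ Y) [Epi p] :
    f Y ≤ f X := by
  have : f X = f (kernel p) + f Y := hf (S := ShortComplex.mk (kernel.ι p) p (kernel.condition p))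
    { exact := ShortComplex.exact_kernel p
      mono_f := inferInstanceAs (Mono (kernel.ι p))
      epi_g := inferInstanceAs (Epi p) }
  linarith [hf₀ (kernel p)]

end IsAdditiveFunction

/-- A cochain complex with finitely many nonzero terms. -/
def IsFinitelySupported (L : CochainComplex A ℤ) : Prop := {i | ¬ IsZero (L.X i)}.Finite

/-- The Euler characteristic of a cochain complex with respect to a function on objects. -/
def eulerChar (f : A → ℤ) (L : CochainComplex A ℤ) : ℤ :=
  ∑ᶠ i : ℤ, (i.negOnePow : ℤ) * f (L.X i)

lemma IsFinitelySupported.hasFiniteSupport {f : A → ℤ} (hf : IsAdditiveFunction f)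
    {L : CochainComplex A ℤ} (hL : IsFinitelySupported L) :
    (Function.support fun i : ℤ => (i.negOnePow : ℤ) * f (L.X i)).Finite := by
  refine hL.subset fun i hi h => hi ?_
  simp [hf.of_isZero h]

/-- No finiteness is needed: reindexing and negation preserve the default value `0` of `finsum`. -/
lemma finsum_negOnePow_shift (u : ℤ → ℤ) :
    ∑ᶠ i : ℤ, (i.negOnePow : ℤ) * u (i + 1) = - ∑ᶠ i : ℤ, (i.negOnePow : ℤ) * u i := by
  rw [← finsum_comp_equiv (Equiv.addRight (1 : ℤ)) (f := fun i : ℤ => (i.negOnePow : ℤ) * u i),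
    ← finsum_neg_distrib]
  simp [Int.negOnePow_succ]

lemma support_negOnePow_shift {u : ℤ → ℤ}
    (hu : (Function.support fun i : ℤ => (i.negOnePow : ℤ) * u i).Finite) :
    (Function.support fun i : ℤ => (i.negOnePow : ℤ) * u (i + 1)).Finite := by
  refine (hu.preimage (f := fun i : ℤ => i + 1) (add_left_injective _).injOn).subset ?_
  intro i hi
  simpa using hi

/-- By acyclicity each term is an extension of the next cycle object by its own, so the alternating
sum telescopes. -/
lemma eulerChar_eq_zero_of_acyclic {f : A → ℤ} (hf : IsAdditiveFunction f)
    {L : CochainComplex A ℤ} (hL : IsFinitelySupported L) (h : L.Acyclic) :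
    eulerChar f L = 0 := by
  have hadd (i : ℤ) : f (L.X i) =
      f (kernel (L.d i (i + 1))) + f (kernel (L.d (i + 1) (i + 1 + 1))) := by
    have hd : L.d i (i + 1) ≫ L.d (i + 1) (i + 1 + 1) = 0 := L.d_comp_d _ _ _
    have hex : (ShortComplex.mk _ _ hd).Exact :=
      (L.exactAt_iff' i (i + 1) (i + 1 + 1) (by simp) (by simp)).1 (h (i + 1))
    have hz : kernel.ι (L.d i (i + 1)) ≫ kernel.lift _ _ hd = 0 := by
      simp [← cancel_mono (kernel.ι _)]
    refine hf (S := ShortComplex.mk _ _ hz)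
      { exact := ?_
        mono_f := inferInstanceAs (Mono (kernel.ι _))
        epi_g := (ShortComplex.exact_iff_epi_kernel_lift _).1 hex }
    rw [ShortComplex.exact_iff_exact_up_to_refinements]
    intro B x hx
    have hx' : x ≫ L.d i (i + 1) = 0 := by
      simpa using hx =≫ kernel.ι (L.d (i + 1) (i + 1 + 1))
    exact ⟨B, 𝟙 B, inferInstance, kernel.lift _ x hx', by simp⟩
  have hcyc : (Function.support fun i : ℤ => (i.negOnePow : ℤ) * f (kernel (L.d i (i + 1)))).Finite := by
    refine hL.subset fun i hi hz => hi ?_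
    simp [hf.of_isZero (hz.of_mono (kernel.ι (L.d i (i + 1))))]
  simp only [eulerChar, hadd, mul_add]
  rw [finsum_add_distrib hcyc
    (support_negOnePow_shift (u := fun i => f (kernel (L.d i (i + 1)))) hcyc),
    finsum_negOnePow_shift fun i => f (kernel (L.d i (i + 1)))]
  exact add_neg_cancel _

lemma eulerChar_single {f : A → ℤ} (hf : IsAdditiveFunction f) (X : A) :
    eulerChar f ((CochainComplex.singleFunctor A 0).obj X) = f X := by
  rw [eulerChar, finsum_eq_single _ 0]
  · rw [Int.negOnePow_zero, Units.val_one, one_mul]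
    exact hf.congr_iso (HomologicalComplex.singleObjXSelf (ComplexShape.up ℤ) 0 X)
  · intro i hi
    exact mul_eq_zero_of_right _
      (hf.of_isZero (HomologicalComplex.isZero_single_obj_X (ComplexShape.up ℤ) 0 X i hi))

lemma isFinitelySupported_single (X : A) :
    IsFinitelySupported ((CochainComplex.singleFunctor A 0).obj X) := by
  refine (Set.finite_singleton 0).subset fun i hi => ?_
  by_contra h
  exact hi (HomologicalComplex.isZero_single_obj_X (ComplexShape.up ℤ) 0 X i h)

lemma IsFinitelySupported.map {L : CochainComplex A ℤ} (hL : IsFinitelySupported L) (F : A ⥤ A)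
    [F.Additive] : IsFinitelySupported ((F.mapHomologicalComplex (ComplexShape.up ℤ)).obj L) :=
  hL.subset fun _ hi h => hi (F.map_isZero h)

section

variable {K L : CochainComplex A ℤ} (φ : K ⟶ L)

lemma IsFinitelySupported.mappingCocone (hK : IsFinitelySupported K) (hL : IsFinitelySupported L) :
    IsFinitelySupported (CochainComplex.mappingCocone φ) := by
  refine (hK.union (hL.preimage (f := fun i : ℤ => i + -1) (add_left_injective _).injOn)).subset ?_
  intro i hi
  by_contra h
  simp only [Set.mem_union, Set.mem_ofPred_eq, Set.mem_preimage, not_or, not_not] at h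
  refine hi ?_
  rw [IsZero.iff_id_eq_zero, ← CochainComplex.mappingCocone.id_X φ i (i + -1) rfl,
    h.1.eq_of_tgt ((CochainComplex.mappingCocone.fst φ).f i) 0,
    h.2.eq_of_tgt ((CochainComplex.mappingCocone.snd φ).v i (i + -1) rfl) 0]
  simp

lemma IsAdditiveFunction.mappingCocone_X {f : A → ℤ} (hf : IsAdditiveFunction f) (i : ℤ) :
    f ((CochainComplex.mappingCocone φ).X (i + 1)) = f (K.X (i + 1)) + f (L.X i) := by
  have e := hf (S := ShortComplex.mk ((CochainComplex.mappingCocone.inr φ).1.v i (i + 1) rfl)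
    ((CochainComplex.mappingCocone.fst φ).f (i + 1)) (by simp)) (ShortComplex.Splitting.shortExact
      { r := (CochainComplex.mappingCocone.snd φ).v (i + 1) i (by lia)
        s := (CochainComplex.mappingCocone.inl φ).v (i + 1) (i + 1) (add_zero _)
        f_r := by simp
        s_g := by simp
        id := by
          rw [← CochainComplex.mappingCocone.id_X φ (i + 1) i (by lia)]
          exact add_comm _ _ })
  exact e.trans (add_comm _ _)

lemma eulerChar_mappingCocone {f : A → ℤ} (hf : IsAdditiveFunction f)
    (hK : IsFinitelySupported K) (hL : IsFinitelySupported L) :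
    eulerChar f (CochainComplex.mappingCocone φ) = eulerChar f K - eulerChar f L := by
  have h₁ := finsum_negOnePow_shift fun i => f ((CochainComplex.mappingCocone φ).X i)
  have h₂ := finsum_negOnePow_shift fun i => f (K.X i)
  simp only [hf.mappingCocone_X, mul_add] at h₁
  rw [finsum_add_distrib (support_negOnePow_shift (hK.hasFiniteSupport hf))
    (hL.hasFiniteSupport hf), h₂] at h₁
  simp only [eulerChar]
  lia

end

end Euler

/-! ### Lengths of lower continuants -/

section Continuants

variable {A : Type u} [Category.{v} A] [Abelian A] (F : ℕ → A ⥤ A)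

/-- The continuants of a function on objects: `c_0 = f`, `c_1(K) = f(F_0 K)` and
`c_{n+2}(K) = c_{n+1}(F_{n+1} K) - c_n(K)`. -/
def continuant (f : A → ℤ) : ℕ → A → ℤ
  | 0 => f
  | 1 => fun K => f ((F 0).obj K)
  | n + 2 => fun K => continuant f (n + 1) ((F (n + 1)).obj K) - continuant f n K

lemma continuant_additive {f : A → ℤ} (hf : IsAdditiveFunction f)
    (hF : ∀ (g : A → ℤ) (n : ℕ), IsAdditiveFunction g →
      IsAdditiveFunction (fun K => g ((F n).obj K))) :
    ∀ n, IsAdditiveFunction (continuant F f n)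
  | 0 => hf
  | 1 => hF _ _ hf
  | n + 2 => (hF _ _ (continuant_additive hf hF (n + 1))).sub (continuant_additive hf hF n)

variable {F} [∀ n, (F n).Additive] (adj : ∀ n, F n ⊣ F (n + 1))

/-- The recursion has two steps, so `prev` and `curr` are treated together; `L` must vary because
`E_{n+2}(L)` involves `E_{n+1}(F_{n+1} L)`. -/
lemma eulerChar_lowerStep {f : A → ℤ} (hf : IsAdditiveFunction f)
    (hF : ∀ (g : A → ℤ) (n : ℕ), IsAdditiveFunction g →
      IsAdditiveFunction (fun K => g ((F n).obj K))) (n : ℕ)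
    {L : CochainComplex A ℤ} (hL : IsFinitelySupported L) :
    (IsFinitelySupported ((lowerStep adj n).prev.obj L) ∧
      eulerChar f ((lowerStep adj n).prev.obj L) = eulerChar (continuant F f n) L) ∧
    (IsFinitelySupported ((lowerStep adj n).curr.obj L) ∧
      eulerChar f ((lowerStep adj n).curr.obj L) = eulerChar (continuant F f (n + 1)) L) := by
  induction n generalizing L with
  | zero => exact ⟨⟨hL, rfl⟩, hL.map (F 0), rfl⟩
  | succ n ih =>
    obtain ⟨⟨h₁, e₁⟩, h₂, e₂⟩ := ih hL
    obtain ⟨-, h₃, e₃⟩ := ih (hL.map (F (n + 1)))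
    refine ⟨⟨h₂, e₂⟩, h₃.mappingCocone _ h₁, ?_⟩
    refine (eulerChar_mappingCocone (((lowerStep adj n).f adj).app L) hf h₃ h₁).trans ?_
    refine (congrArg₂ (· - ·) e₃ e₁).trans ?_
    have hc := continuant_additive F hf hF
    refine (finsum_sub_distrib ((hL.map (F (n + 1))).hasFiniteSupport (hc (n + 1)))
      (hL.hasFiniteSupport (hc n))).symm.trans ?_
    exact finsum_congr fun i => (mul_sub _ _ _).symm

lemma continuant_eq_zero_of_isNSpherical {f : A → ℤ} (hf : IsAdditiveFunction f)
    (hF : ∀ (g : A → ℤ) (n : ℕ), IsAdditiveFunction g →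
      IsAdditiveFunction (fun K => g ((F n).obj K))) {N : ℕ} (hN : IsNSpherical adj N) (X : A) :
    continuant F f (N - 1) X = 0 := by
  obtain ⟨h, e⟩ := (eulerChar_lowerStep adj hf hF (N - 1) (isFinitelySupported_single X)).1
  rw [← eulerChar_single (continuant_additive F hf hF (N - 1)), ← e]
  exact eulerChar_eq_zero_of_acyclic hf h (hN.2 _).1

end Continuants

/-! ### Extensions -/

section Extension

variable {C : Type u} [Category.{v} C] [Abelian C]

/-- `X` is an extension of `B` by `A`. -/
def IsExtension (X A B : C) : Prop :=
  ∃ (i : A ⟶ X) (p : X ⟶ B) (w : i ≫ p = 0), (ShortComplex.mk i p w).ShortExact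

lemma IsAdditiveFunction.extension {f : C → ℤ} (hf : IsAdditiveFunction f) {X A B : C}
    (h : IsExtension X A B) : f X = f A + f B := by
  obtain ⟨i, p, w, hS⟩ := h
  exact hf hS

end Extension

/-! ### Exactness of duality and simplicity of the unit -/

section Rigid

variable {C : Type u} [Category.{v} C] [MonoidalCategory C]

/-- With the next two lemmas: maps `T ⟶ Xᘁ` are maps `T ⊗ X ⟶ 𝟙`, and maps `Xᘁ ⟶ T` are determined
by maps `𝟙 ⟶ X ⊗ T`. -/
lemma hom_ext_evaluation [RightRigidCategory C] {X T : C} {t t' : T ⟶ Xᘁ}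
    (h : t ▷ X ≫ ε_ X Xᘁ = t' ▷ X ≫ ε_ X Xᘁ) : t = t' := by
  have := congrArg (tensorRightHomEquiv T X Xᘁ (𝟙_ C)) h
  simpa using this

lemma exists_whiskerRight_evaluation [RightRigidCategory C] {X T : C} (g : T ⊗ X ⟶ 𝟙_ C) :
    ∃ t : T ⟶ Xᘁ, t ▷ X ≫ ε_ X Xᘁ = g := by
  refine ⟨tensorRightHomEquiv T X Xᘁ (𝟙_ C) g ≫ (λ_ _).hom, ?_⟩
  apply (tensorRightHomEquiv T X Xᘁ (𝟙_ C)).injective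
  rw [tensorRightHomEquiv_whiskerRight_comp_evaluation, Category.assoc, Iso.hom_inv_id,
    Category.comp_id]

lemma hom_ext_coevaluation [RightRigidCategory C] {X T : C} {t t' : Xᘁ ⟶ T}
    (h : η_ X Xᘁ ≫ X ◁ t = η_ X Xᘁ ≫ X ◁ t') : t = t' := by
  have := congrArg (tensorLeftHomEquiv (𝟙_ C) X Xᘁ T).symm h
  simpa using this

variable [Abelian C] [MonoidalPreadditive C] [RigidCategory C]

/-- By rigidity, tensoring on either side has adjoints on both sides, hence is exact. -/
instance (X : C) : PreservesFiniteColimits (tensorRight X) := by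
  have := (tensorRightAdjunction X Xᘁ).leftAdjoint_preservesColimits
  exact PreservesColimitsOfSize.preservesFiniteColimits.{0, 0} _

instance (X : C) : PreservesFiniteLimits (tensorRight X) := by
  have := (tensorRightAdjunction (ᘁX) X).rightAdjoint_preservesLimits
  exact PreservesLimitsOfSize.preservesFiniteLimits.{0, 0} _

instance (X : C) : PreservesFiniteColimits (tensorLeft X) := by
  have := (tensorLeftAdjunction (ᘁX) X).leftAdjoint_preservesColimits
  exact PreservesColimitsOfSize.preservesFiniteColimits.{0, 0} _

instance (X : C) : PreservesFiniteLimits (tensorLeft X) := by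
  have := (tensorLeftAdjunction X Xᘁ).rightAdjoint_preservesLimits
  exact PreservesLimitsOfSize.preservesFiniteLimits.{0, 0} _

/-- The map `s` out of `Yᘁ` is recovered from `η_ Y Yᘁ ≫ Y ◁ s`, even after composing with the mono
`i ▷ T`, and that composite depends only on `iᘁ ≫ s`. -/
lemma epi_rightAdjointMate_of_mono {X Y : C} (i : Y ⟶ X) [Mono i] : Epi (iᘁ) where
  left_cancellation {T} t t' h := by
    have : Mono (i ▷ T) := inferInstanceAs (Mono ((tensorRight T).map i))
    have aux (s : Yᘁ ⟶ T) : η_ X Xᘁ ≫ X ◁ (iᘁ ≫ s) = (η_ Y Yᘁ ≫ Y ◁ s) ≫ i ▷ T := by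
      rw [MonoidalCategory.whiskerLeft_comp, coevaluation_comp_rightAdjointMate_assoc,
        Category.assoc, whisker_exchange]
    apply hom_ext_coevaluation
    rw [← cancel_mono (i ▷ T), ← aux, ← aux, h]

/-- Duality is exact. -/
lemma IsExtension.dual {X A B : C} (h : IsExtension X A B) : IsExtension Xᘁ Bᘁ Aᘁ := by
  obtain ⟨i, p, w, hS⟩ := h
  have := hS.mono_f
  have := hS.epi_g
  -- Composition with `fᘁ` becomes precomposition with `T ◁ f`, so left exactness of the dual
  -- sequence follows from right exactness of `T ⊗ -`.
  have aux {T Y Z : C} (f : Y ⟶ Z) (s : T ⟶ Zᘁ) :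
      (s ≫ fᘁ) ▷ Y ≫ ε_ Y Yᘁ = T ◁ f ≫ s ▷ Z ≫ ε_ Z Zᘁ := by
    rw [comp_whiskerRight, Category.assoc, rightAdjointMate_comp_evaluation,
      whisker_exchange_assoc]
  have hz : pᘁ ≫ iᘁ = 0 := by
    rw [← comp_rightAdjointMate, w]
    apply hom_ext_evaluation
    rw [rightAdjointMate_comp_evaluation]
    simp
  have hp : Epi p := this
  have hw (T : C) : Epi (T ◁ p) := inferInstanceAs (Epi ((tensorLeft T).map p))
  refine ⟨pᘁ, iᘁ, hz, { exact := ?_, mono_f := ?_, epi_g := epi_rightAdjointMate_of_mono i }⟩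
  · rw [ShortComplex.exact_iff_exact_up_to_refinements]
    intro T t ht
    have ht' : T ◁ i ≫ t ▷ X ≫ ε_ X Xᘁ = 0 := by
      rw [← aux, show t ≫ iᘁ = 0 from ht]
      simp
    have hT := hS.map_of_exact (tensorLeft T)
    have := hT.epi_g
    obtain ⟨s, hs⟩ := exists_whiskerRight_evaluation (hT.exact.desc _ ht')
    refine ⟨T, 𝟙 T, inferInstance, s, ?_⟩
    rw [Category.id_comp]
    apply hom_ext_evaluation
    refine Eq.trans ?_ (aux p s).symm
    rw [hs]
    exact (hT.exact.g_desc _ ht').symm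
  · refine ⟨fun {T} t t' h => hom_ext_evaluation ?_⟩
    rw [← cancel_epi (T ◁ p), ← aux, ← aux]
    exact congrArg (fun s => s ▷ X ≫ ε_ X Xᘁ) h

lemma IsExtension.tensorLeft {X A B : C} (h : IsExtension X A B) (K : C) :
    IsExtension (K ⊗ X) (K ⊗ A) (K ⊗ B) := by
  obtain ⟨i, p, w, hS⟩ := h
  exact ⟨K ◁ i, K ◁ p, _, hS.map_of_exact (MonoidalCategory.tensorLeft K)⟩

/-- If the evaluation vanished, a triangle identity would give `𝟙 X = 0`. -/
lemma evaluation_ne_zero {X : C} (hX : ¬ IsZero X) : ε_ X Xᘁ ≠ 0 := by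
  intro h
  refine hX ((IsZero.iff_id_eq_zero X).2 ?_)
  have e := ExactPairing.evaluation_coevaluation X Xᘁ
  rw [h] at e
  simpa using ((λ_ X).inv ≫= e =≫ (ρ_ X).hom).symm

lemma coevaluation_ne_zero {X : C} (hX : ¬ IsZero X) : η_ X Xᘁ ≠ 0 := by
  intro h
  refine hX ((IsZero.iff_id_eq_zero X).2 ?_)
  have e := ExactPairing.evaluation_coevaluation X Xᘁ
  rw [h] at e
  simpa using ((λ_ X).inv ≫= e =≫ (ρ_ X).hom).symm

lemma not_isZero_dual {X : C} (hX : ¬ IsZero X) : ¬ IsZero Xᘁ := fun h =>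
  evaluation_ne_zero hX (((tensorRight X).map_isZero h).eq_of_src _ _)

/-- A mono from a simple object to the unit is an isomorphism, if all nonzero endomorphisms of the
unit are invertible. -/
lemma isIso_of_simple_of_mono_unit (hend : ∀ f : 𝟙_ C ⟶ 𝟙_ C, f ≠ 0 → IsIso f) {U : C} [Simple U]
    (i : U ⟶ 𝟙_ C) [Mono i] : IsIso i := by
  have hU : ¬ IsZero U := Simple.not_isZero U
  -- The dual of `i`, up to identifying `𝟙` with its dual; it is epi as in
  -- `epi_rightAdjointMate_of_mono`.
  let e : 𝟙_ C ⟶ Uᘁ := η_ U Uᘁ ≫ i ▷ Uᘁ ≫ (λ_ Uᘁ).hom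
  have : Epi e := by
    refine ⟨fun {T} t t' h => hom_ext_coevaluation ?_⟩
    have aux (s : Uᘁ ⟶ T) : e ≫ s = (η_ U Uᘁ ≫ U ◁ s) ≫ i ▷ T ≫ (λ_ T).hom := by
      simp only [e, Category.assoc, whisker_exchange_assoc, id_whiskerLeft, Iso.inv_hom_id,
        Category.comp_id]
    have : Mono (i ▷ T) := inferInstanceAs (Mono ((tensorRight T).map i))
    rw [← cancel_mono (i ▷ T ≫ (λ_ T).hom), ← aux, ← aux, h]
  have : Epi (U ◁ e) := inferInstanceAs (Epi ((tensorLeft U).map e))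
  have hη := coevaluation_ne_zero hU
  have hne : (ρ_ U).inv ≫ U ◁ e ≠ 0 := fun h =>
    hη ((IsZero.of_epi_eq_zero _ h).eq_of_tgt _ _)
  -- Simplicity gives `U ≅ U ⊗ Uᘁ`, so coevaluation yields a nonzero `s : 𝟙 ⟶ U`. Then `s ≫ i` is a
  -- nonzero endomorphism of `𝟙`, which makes `i` epi.
  have : IsIso ((ρ_ U).inv ≫ U ◁ e) := isIso_of_epi_of_nonzero hne
  let s : 𝟙_ C ⟶ U := η_ U Uᘁ ≫ inv ((ρ_ U).inv ≫ U ◁ e)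
  have hs : s ≫ i ≠ 0 := fun h => hη <| by
    have h' : s = 0 := by rwa [← cancel_mono i, zero_comp]
    simpa [s] using h' =≫ ((ρ_ U).inv ≫ U ◁ e)
  have := hend _ hs
  have : Epi i := epi_of_epi s i
  exact isIso_of_mono_of_epi i

lemma simple_unit [∀ X : C, FiniteDimensionalOrder (Subobject X)] (h₀ : ¬ IsZero (𝟙_ C))
    (hend : ∀ f : 𝟙_ C ⟶ 𝟙_ C, f ≠ 0 → IsIso f) : Simple (𝟙_ C) := by
  have := isArtinianObject_of_finiteDimensionalOrder (𝟙_ C)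
  have := isIso_of_simple_of_mono_unit hend (simpleSubobjectArrow h₀)
  exact Simple.of_iso (asIso (simpleSubobjectArrow h₀)).symm

end Rigid

/-! ### Positivity of continuants -/

section Positivity

variable {C : Type u} [Category.{v} C] [Abelian C] [MonoidalCategory C]

/-- Continuants of a sequence of extensions `X_n` of `Y_n` and `Z_n` are positive, provided that
`K` is a quotient of `K ⊗ Y_{n+1} ⊗ Y_n` and of `K ⊗ Z_{n+1} ⊗ Z_n` for all `K`. -/
lemma continuant_mono {X Y Z : ℕ → C}
    (htensor : ∀ (g : C → ℤ) (Y : C), IsAdditiveFunction g →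
      IsAdditiveFunction (fun K => g (K ⊗ Y)))
    (hext : ∀ (g : C → ℤ) (n : ℕ) (K : C), IsAdditiveFunction g →
      g (K ⊗ X n) = g (K ⊗ Y n) + g (K ⊗ Z n))
    (hY : ∀ (n : ℕ) (K : C), ∃ p : (K ⊗ Y (n + 1)) ⊗ Y n ⟶ K, Epi p)
    (hZ : ∀ (n : ℕ) (K : C), ∃ p : (K ⊗ Z (n + 1)) ⊗ Z n ⟶ K, Epi p)
    {f : C → ℤ} (hf : IsAdditiveFunction f) (hf₀ : ∀ K, 0 ≤ f K) (n : ℕ) (K : C) :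
    continuant (fun n => tensorRight (X n)) f n K ≤
      continuant (fun n => tensorRight (X n)) f (n + 2) K := by
  set c := continuant (fun n => tensorRight (X n)) f with hc
  have hadd : ∀ n, IsAdditiveFunction (c n) :=
    continuant_additive _ hf fun g n hg => htensor g (X n) hg
  have hrec (n : ℕ) (K : C) :
      c (n + 2) K = c (n + 1) (K ⊗ Y (n + 1)) + c (n + 1) (K ⊗ Z (n + 1)) - c n K := by
    rw [← hext _ _ _ (hadd (n + 1))]
    rfl
  -- Nonnegativity alone is not inductive; it is carried along with the bounds of `c n K` by the `Y`
  -- part and by the `Z` part.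
  have key (n : ℕ) : (∀ K, 0 ≤ c n K) ∧ (∀ K, 0 ≤ c (n + 1) K) ∧
      (∀ K, c n K ≤ c (n + 1) (K ⊗ Y (n + 1))) ∧ ∀ K, c n K ≤ c (n + 1) (K ⊗ Z (n + 1)) := by
    induction n with
    | zero =>
      have h₁ (K : C) : c 1 K = f (K ⊗ Y 0) + f (K ⊗ Z 0) := hext f 0 K hf
      refine ⟨hf₀, fun K => hf₀ _, fun K => ?_, fun K => ?_⟩
      · obtain ⟨p, hp⟩ := hY 0 K
        rw [h₁]
        exact (hf.le_of_epi hf₀ p).trans (le_add_of_nonneg_right (hf₀ _))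
      · obtain ⟨p, hp⟩ := hZ 0 K
        rw [h₁]
        exact (hf.le_of_epi hf₀ p).trans (le_add_of_nonneg_left (hf₀ _))
    | succ n ih =>
      obtain ⟨-, h₁, h₂, h₃⟩ := ih
      -- The `Z` part absorbs the subtracted `c n K`.
      have hle (K : C) : c (n + 1) (K ⊗ Y (n + 1)) ≤ c (n + 2) K := by
        linarith [hrec n K, h₃ K]
      have hle' (K : C) : c (n + 1) (K ⊗ Z (n + 1)) ≤ c (n + 2) K := by
        linarith [hrec n K, h₂ K]
      refine ⟨h₁, fun K => (h₁ _).trans (hle K), fun K => ?_, fun K => ?_⟩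
      · obtain ⟨p, hp⟩ := hY (n + 1) K
        exact ((hadd (n + 1)).le_of_epi h₁ p).trans (hle _)
      · obtain ⟨p, hp⟩ := hZ (n + 1) K
        exact ((hadd (n + 1)).le_of_epi h₁ p).trans (hle' _)
  -- The two parts give `2 c_n - c_n`.
  linarith [hrec n K, (key n).2.2.1 K, (key n).2.2.2 K]

lemma exists_epi_iteratedDual [MonoidalPreadditive C] [RigidCategory C] [Simple (𝟙_ C)] {Y : C}
    (hY : ¬ IsZero Y) (n : ℕ) (K : C) :
    ∃ p : (K ⊗ iteratedDual Y (n + 1)) ⊗ iteratedDual Y n ⟶ K, Epi p := by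
  have hn (n : ℕ) : ¬ IsZero (iteratedDual Y n) := by
    induction n with
    | zero => exact hY
    | succ n ih => exact not_isZero_dual ih
  have : Epi (ε_ (iteratedDual Y n) (iteratedDual Y n)ᘁ) :=
    epi_of_nonzero_to_simple (evaluation_ne_zero (hn n))
  have : Epi (K ◁ ε_ (iteratedDual Y n) (iteratedDual Y n)ᘁ) :=
    inferInstanceAs (Epi ((tensorLeft K).map (ε_ (iteratedDual Y n) (iteratedDual Y n)ᘁ)))
  exact ⟨(α_ _ _ _).hom ≫ K ◁ ε_ (iteratedDual Y n) (iteratedDual Y n)ᘁ ≫ (ρ_ K).hom,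
    epi_comp' inferInstance (epi_comp' this inferInstance)⟩

/-- Duality is contravariant, so subobject and quotient swap roles at each step. -/
lemma isExtension_iteratedDual [MonoidalPreadditive C] [RigidCategory C] {X Y Z : C}
    (h : IsExtension X Y Z) (n : ℕ) :
    IsExtension (iteratedDual X n) (iteratedDual Y n) (iteratedDual Z n) ∨
      IsExtension (iteratedDual X n) (iteratedDual Z n) (iteratedDual Y n) := by
  induction n with
  | zero => exact Or.inl h
  | succ n ih => exact ih.symm.imp IsExtension.dual IsExtension.dual

/-- Monotonicity advances by two, hence two base cases. -/
lemma continuant_pos [MonoidalPreadditive C] [RigidCategory C] [Simple (𝟙_ C)]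
    {X Y Z : C} (h : IsExtension X Y Z) (hY : ¬ IsZero Y) (hZ : ¬ IsZero Z)
    {f : C → ℤ} (hf : IsAdditiveFunction f) (hf₀ : ∀ K, ¬ IsZero K → 0 < f K) :
    ∀ n, 0 < continuant (fun n => tensorRight (iteratedDual X n)) f n (𝟙_ C)
  | 0 => hf₀ _ (Simple.not_isZero _)
  | 1 => by
    obtain ⟨i, p, w, hS⟩ := h
    have := hS.mono_f
    refine hf₀ _ fun hz => hY ?_
    exact ((hz.of_iso (λ_ X).symm).of_mono i)
  | n + 2 => by
    have hf₁ (K : C) : 0 ≤ f K := by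
      by_cases hK : IsZero K
      · exact (hf.of_isZero hK).ge
      · exact (hf₀ K hK).le
    refine (continuant_pos h hY hZ hf hf₀ n).trans_le ?_
    refine continuant_mono (fun g Y hg => hg.comp_functor (tensorRight Y)) (fun g n K hg => ?_)
      (exists_epi_iteratedDual hY) (exists_epi_iteratedDual hZ) hf hf₁ n (𝟙_ C)
    rcases isExtension_iteratedDual h n with h | h
    · exact hg.extension (h.tensorLeft K)
    · exact (hg.extension (h.tensorLeft K)).trans (add_comm _ _)

end Positivity

end

end BoundedObj

theorem theorem3p3 {k : Type w} [Field k] {C : Type u} [Category.{v} C] [Abelian C]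
    [Linear k C] [MonoidalCategory C] [MonoidalPreadditive C] [MonoidalLinear k C]
    [RigidCategory C] [BoundedObj.IsTensorCategory k C] (X : C) (hX : BoundedObj.IsBounded X) :
    Simple X ∨ IsZero X := by
  have : ∀ X : C, FiniteDimensionalOrder (Subobject X) :=
    BoundedObj.IsTensorCategory.finite_length k
  have hbij := BoundedObj.IsTensorCategory.end_unit (k := k) (C := C)
  have h₀ : ¬ IsZero (𝟙_ C) := fun h =>
    one_ne_zero (hbij.injective (h.eq_of_src ((1 : k) • 𝟙 (𝟙_ C)) ((0 : k) • 𝟙 (𝟙_ C))))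
  have hend (f : 𝟙_ C ⟶ 𝟙_ C) (hf : f ≠ 0) : IsIso f := by
    obtain ⟨a, rfl⟩ := hbij.surjective f
    have ha : a ≠ 0 := by
      rintro rfl
      exact hf (zero_smul k _)
    exact ⟨a⁻¹ • 𝟙 (𝟙_ C), by simp [smul_smul, ha], by simp [smul_smul, ha]⟩
  have := BoundedObj.simple_unit h₀ hend
  refine or_iff_not_imp_right.2 fun hX₀ => ?_
  have := BoundedObj.isArtinianObject_of_finiteDimensionalOrder X
  let i := simpleSubobjectArrow hX₀
  -- Either the simple subobject is all of `X`, or `X` is a nontrivial extension to which positivity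
  -- applies.
  by_cases hZ : IsZero (cokernel i)
  · have : Epi i := Preadditive.epi_of_isZero_cokernel i hZ
    have : IsIso i := isIso_of_mono_of_epi i
    exact Simple.of_iso (asIso i).symm
  · exfalso
    obtain ⟨N, hN⟩ := hX
    have hf : BoundedObj.IsAdditiveFunction (fun K : C => (BoundedObj.objLength K : ℤ)) :=
      fun S hS =>
        (congrArg Nat.cast (BoundedObj.objLength_eq_add hS)).trans (Nat.cast_add _ _)
    have hext : BoundedObj.IsExtension X (simpleSubobject hX₀) (cokernel i) :=
      ⟨i, cokernel.π i, cokernel.condition i,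
        { exact := ShortComplex.exact_cokernel i
          mono_f := inferInstanceAs (Mono i)
          epi_g := inferInstanceAs (Epi (cokernel.π i)) }⟩
    refine (BoundedObj.continuant_pos hext (Simple.not_isZero _) hZ hf
      (fun K hK => by exact_mod_cast BoundedObj.objLength_pos hK) (N - 1)).ne' ?_
    exact BoundedObj.continuant_eq_zero_of_isNSpherical _ hf
      (fun g n hg => hg.comp_functor (tensorRight _)) hN _
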